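/- Let $m\ge 1$ be an integer. For real $\alpha$ let $L_m^{(\alpha)}(x)=\sum_{k=0}^{m}(-1)^k\binom{m+\alpha}{m-k}\frac{x^k}{k!}$ be the generalized Laguerre polynomial, and let $H_m$ be the (physicists') Hermite polynomial, orthogonal with respect to $e^{-x^2}$ and with leading coefficient $2^m$. For $q>0$ put $$\mathcal N_q[H_m]=\int_{-\infty}^{\infty}|H_m(x)|^q e^{-x^2}\,dx,\qquad \mathcal N_q[L_m^{(\alpha)}]=\int_0^\infty |L_m^{(\alpha)}(x)|^q x^\alpha e^{-x}\,dx,$$ $$E[L_m^{(\alpha)}]=-\int_0^\infty \bigl(L_m^{(\alpha)}(x)\bigr)^2 x^\alpha e^{-x}\ln\bigl(L_m^{(\alpha)}(x)\bigr)^2\,dx,\qquad c_{m,q}=\frac{\mathcal N_q[H_m]}{(m!)^q\,2^{(mq-1)/2}} .$$ Here $f(\alpha)\sim g(\alpha)$ means $f(\alpha)/g(\alpha)\to 1$ as $\alpha\to\infty$, with all other parameters fixed, and $0\ln 0=0$. 1. For every real $\delta$ and every $q>0$, the integral defining $\mathcal N_q[H_m]$ converges, the integral below converges whenever $\alpha>-1$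 and $\alpha+\delta>-1$, and $$\int_0^\infty x^{\alpha+\delta}e^{-x}\bigl|L_m^{(\alpha)}(x)\bigr|^q\,dx\;\sim\; c_{m,q}\left(\frac{\alpha}{e}\right)^{\alpha}\alpha^{\delta+(mq+1)/2}\qquad(\alpha\to\infty).$$ 2. For every real $\delta$, the integral below converges absolutely whenever $\alpha>-1$ and $\alpha+\delta>-1$, and $$\int_0^\infty x^{\alpha+\delta}e^{-x}\bigl|L_m^{(\alpha)}(x)\bigr|^2\ln\bigl|L_m^{(\alpha)}(x)\bigr|^2\,dx\;\sim\;\frac{\sqrt{2\pi}}{(m-1)!}\left(\frac{\alpha}{e}\right)^{\alpha}\alpha^{\delta+m+1/2}\ln\alpha\qquad(\alpha\to\infty).$$ 3. For every $q>0$, $$\mathcal N_q[L_m^{(\alpha)}]\;\sim\; c_{m,q}\left(\frac{\alpha}{e}\right)^{\alpha}\alpha^{(mq+1)/2}\qquad(\alpha\to\infty).$$ 4. $$E[L_m^{(\alpha)}]\;\sim\;-\frac{\sqrt{2\pi}}{(m-1)!}\left(\frac{\alpha}{e}\right)^{\alpha}\alpha^{m+1/2}\ln\alpha\qquad(\alpha\to\infty).$$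 -/

import Mathlib

open Filter Asymptotics MeasureTheory
open scoped Nat

noncomputable section

/-- The generalized Laguerre polynomial
`L_n^{(α)}(x) = ∑_{k=0}^n (-1)^k * binom(n+α, n-k) * x^k / k!`, where for real `α` the binomial
coefficient `binom(n+α, n-k)` is `(α+k+1)(α+k+2)⋯(α+n) / (n-k)!`. -/
def laguerreL (n : ℕ) (α : ℝ) (x : ℝ) : ℝ :=
  ∑ k ∈ Finset.range (n + 1),
    (-1) ^ k * ((∏ j ∈ Finset.Icc (k + 1) n, (α + (j : ℝ))) / ((n - k)! : ℝ)) * (x ^ k / (k ! : ℝ))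

/-- The (physicists') Hermite polynomial `H_n(x) = 2^{n/2} He_n(√2 x)`, with leading
coefficient `2^n`, orthogonal with respect to `exp (-x^2)`; here `He_n` is Mathlib's
(probabilists') `Polynomial.hermite n`. -/
def hermiteH (n : ℕ) (x : ℝ) : ℝ :=
  (Real.sqrt 2) ^ n * Polynomial.aeval (Real.sqrt 2 * x) (Polynomial.hermite n)

/-- The Hermite weight on the real line. -/
def hermiteWeight (x : ℝ) : ℝ := Real.exp (-x ^ 2)

/-- The Laguerre weight on `(0, ∞)`. -/
def laguerreWeight (α : ℝ) (x : ℝ) : ℝ := x ^ α * Real.exp (-x)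

/-- The unweighted norm `𝒩_q[p] = ∫_Λ |p(x)|^q h(x) dx`. -/
def unweightedNorm (Λ : Set ℝ) (h : ℝ → ℝ) (q : ℝ) (p : ℝ → ℝ) : ℝ :=
  ∫ x in Λ, |p x| ^ q * h x

/-- The Shannon entropy functional `E[p] = -∫_Λ p(x)^2 h(x) ln (p(x)^2) dx`. -/
def shannonE (Λ : Set ℝ) (h : ℝ → ℝ) (p : ℝ → ℝ) : ℝ :=
  -∫ x in Λ, p x ^ 2 * h x * Real.log (p x ^ 2)

/-- `𝒩_q[H_n]`. -/
def normHermite (q : ℝ) (n : ℕ) : ℝ :=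
  unweightedNorm Set.univ hermiteWeight q (hermiteH n)

/-- `𝒩_q[L_n^{(α)}]`. -/
def normLaguerre (q : ℝ) (n : ℕ) (α : ℝ) : ℝ :=
  unweightedNorm (Set.Ioi 0) (laguerreWeight α) q (laguerreL n α)

/-- `E[L_n^{(α)}]`. -/
def entropyLaguerre (n : ℕ) (α : ℝ) : ℝ :=
  shannonE (Set.Ioi 0) (laguerreWeight α) (laguerreL n α)

/-- The constant `c_{m,q} = 𝒩_q[H_m] / ((m!)^q 2^{(mq-1)/2})`. -/
def constC (m : ℕ) (q : ℝ) : ℝ :=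
  normHermite q m / ((m ! : ℝ) ^ q * (2 : ℝ) ^ (((m : ℝ) * q - 1) / 2))

end

open scoped Topology

/-! For large `α` the weight `x ^ α * exp (-x)` concentrates near `x = α` on the scale `√(2α)`. With
`s = √(2/α)` and `x = α (1 + s t)`, the weight `x ^ (α + δ) * exp (-x)` divided by `(α/e) ^ α * α ^
δ` tends to `exp (-t ^ 2)`, and the Jacobian is `√(2α)`.

In the same variable `Q = s ^ m * L_m` tends to `(-1) ^ m * H_m(t) / m!`. Multiplied by `s ^ n`, the
Laguerre recurrence becomes a recurrence with coefficients polynomial in `s` and `t`, whose value at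
`s = 0` is a signed, normalised Hermite recurrence (`scaledLaguerre_eq`, `scaledLaguerre_zero`).
Hence `|L_m| ^ q` contributes `(α/2) ^ (mq/2) * |H_m| ^ q / (m!) ^ q`.

Dominated convergence (`tendsto_integral_rpow_mul_exp_neg`) justifies the limit: the weight is at
most `exp (1/4 - |t|/8)` uniformly in small `s` (`logWeight_le`), while `Q` grows more slowly than
any `exp (ε |t|)`, uniformly for `0 ≤ s ≤ 1` (`exists_abs_scaledLaguerre_le`).

For the entropy, `log L_m² = m log (α/2) + log Q²`. After division by `log α` only `m Q²` survives,
so the constant is `m * c_{m,2}`, evaluated from the Hermite squared norm. -/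

noncomputable section

/-! ### Three-term recurrence of the Laguerre polynomials -/

/-- The coefficient of `x ^ k` in `laguerreL n α`, zero for `k > n`. -/
def laguerreCoeff (α : ℝ) (n k : ℕ) : ℝ :=
  if k ≤ n then
    (-1) ^ k * ((∏ j ∈ Finset.Icc (k + 1) n, (α + (j : ℝ))) / ((n - k)! : ℝ)) / (k ! : ℝ)
  else 0

lemma laguerreL_eq_sum_coeff (α x : ℝ) {n N : ℕ} (h : n < N) :
    laguerreL n α x = ∑ k ∈ Finset.range N, laguerreCoeff α n k * x ^ k := by
  have hsub : Finset.range (n + 1) ⊆ Finset.range N := by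
    intro k; simp only [Finset.mem_range]; omega
  rw [← Finset.sum_subset hsub]
  · refine Finset.sum_congr rfl fun k hk => ?_
    rw [laguerreCoeff, if_pos (by simpa [Nat.lt_succ_iff] using hk)]
    ring
  · intro k _ hk
    rw [laguerreCoeff, if_neg (by simpa [Nat.lt_succ_iff] using hk), zero_mul]

lemma laguerreCoeff_of_lt (α : ℝ) {n k : ℕ} (h : n < k) : laguerreCoeff α n k = 0 :=
  if_neg (by omega)

lemma laguerreCoeff_self (α : ℝ) (k : ℕ) : laguerreCoeff α k k = (-1) ^ k / (k ! : ℝ) := by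
  simp [laguerreCoeff]

lemma laguerreCoeff_add_succ (α : ℝ) (k i : ℕ) :
    laguerreCoeff α (k + i + 1) k =
      (α + k + i + 1) / (i + 1) * laguerreCoeff α (k + i) k := by
  rw [laguerreCoeff, laguerreCoeff, if_pos (by omega), if_pos (by omega),
    Finset.prod_Icc_succ_top (by omega), show k + i + 1 - k = i + 1 by omega,
    show k + i - k = i by omega, Nat.factorial_succ]
  have := Nat.factorial_ne_zero i
  have := Nat.factorial_ne_zero k
  push_cast
  field_simp
  ring

lemma laguerreCoeff_eq_mul_succ (α : ℝ) (k i : ℕ) :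
    laguerreCoeff α (k + 1 + i) k =
      -((α + k + 1) * (k + 1) / (i + 1)) * laguerreCoeff α (k + 1 + i) (k + 1) := by
  rw [laguerreCoeff, laguerreCoeff, if_pos (by omega), if_pos (by omega),
    ← Finset.mul_prod_Ioc_eq_prod_Icc (by omega : k + 1 ≤ k + 1 + i),
    show Finset.Ioc (k + 1) (k + 1 + i) = Finset.Icc (k + 1 + 1) (k + 1 + i) by
      ext; simp,
    show k + 1 + i - k = i + 1 by omega,
    show k + 1 + i - (k + 1) = i by omega, Nat.factorial_succ, Nat.factorial_succ]
  have := Nat.factorial_ne_zero i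
  have := Nat.factorial_ne_zero k
  push_cast
  field_simp
  ring

lemma laguerreCoeff_recurrence_zero (α : ℝ) (n : ℕ) :
    (n + 2) * laguerreCoeff α (n + 2) 0 =
      (2 * n + 3 + α) * laguerreCoeff α (n + 1) 0 - (n + 1 + α) * laguerreCoeff α n 0 := by
  have h1 := laguerreCoeff_add_succ α 0 n
  have h2 := laguerreCoeff_add_succ α 0 (n + 1)
  simp only [zero_add, Nat.cast_zero, add_zero, ← add_assoc] at h1 h2
  rw [show n + 2 = n + 1 + 1 from rfl, h2, h1]
  push_cast
  field_simp
  ring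

lemma laguerreCoeff_recurrence_succ (α : ℝ) (n k : ℕ) :
    (n + 2) * laguerreCoeff α (n + 2) (k + 1) =
      (2 * n + 3 + α) * laguerreCoeff α (n + 1) (k + 1) - laguerreCoeff α (n + 1) k
        - (n + 1 + α) * laguerreCoeff α n (k + 1) := by
  -- For `k < n` the ratio formulas reduce all four coefficients to multiples of one. The boundary
  -- cases are `k = n`, where `L_n` has no term, `k = n + 1`, which compares leading coefficients,
  -- and larger `k`, where all vanish.
  rcases lt_trichotomy (k + 1) (n + 1) with h | h | h
  · obtain ⟨i, rfl⟩ := Nat.exists_eq_add_of_le (Nat.le_of_lt_succ h)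
    have h1 := laguerreCoeff_add_succ α (k + 1) i
    have h2 := laguerreCoeff_add_succ α (k + 1) (i + 1)
    have h3 := laguerreCoeff_eq_mul_succ α k (i + 1)
    simp only [← add_assoc] at h1 h2 h3
    rw [show k + 1 + i + 2 = k + 1 + i + 1 + 1 from rfl, h3, h2, h1]
    push_cast
    field_simp
    ring
  · obtain rfl : k = n := by omega
    have h1 := laguerreCoeff_add_succ α (k + 1) 0
    have h3 := laguerreCoeff_eq_mul_succ α k 0
    simp only [add_zero] at h1 h3
    rw [show k + 2 = k + 1 + 1 from rfl, h3, h1, laguerreCoeff_of_lt α (Nat.lt_succ_self k)]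
    push_cast
    field_simp
    ring
  · rcases Nat.lt_or_ge (n + 1) k with h' | h'
    · rw [laguerreCoeff_of_lt, laguerreCoeff_of_lt, laguerreCoeff_of_lt, laguerreCoeff_of_lt]
      · ring
      all_goals omega
    · obtain rfl : k = n + 1 := by omega
      rw [laguerreCoeff_of_lt α h, laguerreCoeff_of_lt α (by omega : n < n + 1 + 1),
        laguerreCoeff_self, laguerreCoeff_self, Nat.factorial_succ (n + 1)]
      have := Nat.factorial_ne_zero (n + 1)
      push_cast
      field_simp
      ring

/-- The three-term recurrence of the generalized Laguerre polynomials. -/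
theorem laguerreL_recurrence (n : ℕ) (α x : ℝ) :
    (n + 2) * laguerreL (n + 2) α x =
      (2 * n + 3 + α - x) * laguerreL (n + 1) α x - (n + 1 + α) * laguerreL n α x := by
  have hx : x * laguerreL (n + 1) α x =
      ∑ k ∈ Finset.range (n + 2), laguerreCoeff α (n + 1) k * x ^ (k + 1) := by
    rw [laguerreL_eq_sum_coeff α x (Nat.lt_succ_self (n + 1)), Finset.mul_sum]
    exact Finset.sum_congr rfl fun k _ => by ring
  rw [sub_mul, hx, laguerreL_eq_sum_coeff α x (Nat.lt_succ_self (n + 2)),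
    laguerreL_eq_sum_coeff α x (by omega : n + 1 < n + 2 + 1),
    laguerreL_eq_sum_coeff α x (by omega : n < n + 2 + 1),
    Finset.sum_range_succ' _ (n + 2), Finset.sum_range_succ' _ (n + 2),
    Finset.sum_range_succ' _ (n + 2)]
  simp only [mul_add, Finset.mul_sum]
  have h0 := laguerreCoeff_recurrence_zero α n
  have hs : ∑ k ∈ Finset.range (n + 2), ((n : ℝ) + 2) * (laguerreCoeff α (n + 2) (k + 1) * x ^ (k + 1))
      = ∑ k ∈ Finset.range (n + 2), ((2 * n + 3 + α) * (laguerreCoeff α (n + 1) (k + 1) * x ^ (k + 1))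
        - laguerreCoeff α (n + 1) k * x ^ (k + 1)
        - (n + 1 + α) * (laguerreCoeff α n (k + 1) * x ^ (k + 1))) := by
    refine Finset.sum_congr rfl fun k _ => ?_
    linear_combination x ^ (k + 1) * laguerreCoeff_recurrence_succ α n k
  simp only [Finset.sum_sub_distrib] at hs
  linear_combination hs + h0

lemma laguerreL_zero (α x : ℝ) : laguerreL 0 α x = 1 := by
  simp [laguerreL]

lemma laguerreL_one (α x : ℝ) : laguerreL 1 α x = 1 + α - x := by
  simp [laguerreL, Finset.sum_range_succ]
  ring

lemma continuous_laguerreL (n : ℕ) (α : ℝ) : Continuous (laguerreL n α) := by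
  unfold laguerreL
  fun_prop

/-! ### Rescaled Laguerre polynomials and their Hermite limit -/

/-- The rescaled polynomials `s ^ n * laguerreL n (2 / s ^ 2) (2 / s ^ 2 + 2 * t / s)`, defined
by their recurrence so that they make sense at `s = 0`. -/
def scaledLaguerre : ℕ → ℝ → ℝ → ℝ
  | 0, _, _ => 1
  | 1, s, t => s - 2 * t
  | n + 2, s, t =>
    (((2 * n + 3) * s - 2 * t) * scaledLaguerre (n + 1) s t
      - (2 + (n + 1) * s ^ 2) * scaledLaguerre n s t) / (n + 2)

lemma continuous_scaledLaguerre (n : ℕ) :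
    Continuous fun p : ℝ × ℝ => scaledLaguerre n p.1 p.2 := by
  induction n using Nat.twoStepInduction with
  | zero => simp only [scaledLaguerre]; fun_prop
  | one => simp only [scaledLaguerre]; fun_prop
  | more n h0 h1 => simp only [scaledLaguerre]; fun_prop

theorem scaledLaguerre_eq (n : ℕ) {s : ℝ} (hs : s ≠ 0) (t : ℝ) :
    scaledLaguerre n s t = s ^ n * laguerreL n (2 / s ^ 2) (2 / s ^ 2 + 2 * t / s) := by
  induction n using Nat.twoStepInduction with
  | zero => simp [scaledLaguerre, laguerreL_zero]
  | one =>
    rw [scaledLaguerre, laguerreL_one]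
    field_simp
    ring
  | more n h0 h1 =>
    have hn : (n : ℝ) + 2 ≠ 0 := by positivity
    rw [scaledLaguerre, h0, h1, div_eq_iff hn]
    have hα : 2 / s ^ 2 * s ^ 2 = 2 := by field_simp
    have hx : 2 * t / s * s = 2 * t := by field_simp
    generalize 2 / s ^ 2 = α at *
    generalize 2 * t / s = y at *
    -- This is the Laguerre recurrence times `s ^ (n + 2)`: the argument is `α + y`, so `α` cancels
    -- in the first factor, and `y s = 2 t`, `α s ^ 2 = 2` absorb the negative powers of `s`.
    linear_combination (-s ^ (n + 2)) * laguerreL_recurrence n α (α + y)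
      + s ^ (n + 1) * laguerreL (n + 1) α (α + y) * hx + s ^ n * laguerreL n α (α + y) * hα

lemma derivative_hermite_succ (n : ℕ) :
    Polynomial.derivative (Polynomial.hermite (n + 1)) =
      ((n : Polynomial ℤ) + 1) * Polynomial.hermite n := by
  induction n with
  | zero => simp
  | succ n ih =>
    rw [Polynomial.hermite_succ (n + 1), Polynomial.derivative_sub, Polynomial.derivative_mul, ih,
      Polynomial.derivative_mul, Polynomial.derivative_X]
    have h := Polynomial.hermite_succ n
    simp only [Polynomial.derivative_add, Polynomial.derivative_natCast, Polynomial.derivative_one]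
    push_cast
    linear_combination (-((n : Polynomial ℤ) + 1)) * h

lemma hermiteH_zero (x : ℝ) : hermiteH 0 x = 1 := by simp [hermiteH]

lemma hermiteH_one (x : ℝ) : hermiteH 1 x = 2 * x := by
  simp [hermiteH]
  linear_combination x * Real.mul_self_sqrt (zero_le_two : (0 : ℝ) ≤ 2)

theorem hermiteH_recurrence (n : ℕ) (x : ℝ) :
    hermiteH (n + 2) x = 2 * x * hermiteH (n + 1) x - 2 * (n + 1) * hermiteH n x := by
  have h2 : Real.sqrt 2 ^ 2 = 2 := Real.sq_sqrt zero_le_two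
  rw [hermiteH, hermiteH, hermiteH, Polynomial.hermite_succ (n + 1), derivative_hermite_succ]
  simp only [map_sub, map_mul, map_add, map_natCast, map_one, Polynomial.aeval_X]
  rw [pow_add, h2]
  ring

lemma hasDerivAt_hermiteH (n : ℕ) (x : ℝ) :
    HasDerivAt (hermiteH n) (2 * x * hermiteH n x - hermiteH (n + 1) x) x := by
  have h2 : Real.sqrt 2 ^ 2 = 2 := Real.sq_sqrt zero_le_two
  have h := ((Polynomial.hasDerivAt_aeval (Polynomial.hermite n) (Real.sqrt 2 * x)).comp x
    ((hasDerivAt_id x).const_mul (Real.sqrt 2))).const_mul (Real.sqrt 2 ^ n)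
  refine h.congr_deriv ?_
  rw [hermiteH, hermiteH, Polynomial.hermite_succ n]
  simp only [map_sub, map_mul, Polynomial.aeval_X]
  linear_combination (x * Real.sqrt 2 ^ n
    * (Polynomial.aeval (Real.sqrt 2 * x)) (Polynomial.hermite n)) * h2

lemma continuous_hermiteH (n : ℕ) : Continuous (hermiteH n) :=
  continuous_iff_continuousAt.2 fun x => (hasDerivAt_hermiteH n x).continuousAt

lemma hasDerivAt_hermiteH_succ (n : ℕ) (x : ℝ) :
    HasDerivAt (hermiteH (n + 1)) (2 * (n + 1) * hermiteH n x) x :=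
  (hasDerivAt_hermiteH (n + 1) x).congr_deriv (by rw [hermiteH_recurrence]; ring)

/-- At `s = 0` the recurrence reads `(n + 2) Q_{n+2} = -2 t Q_{n+1} - 2 Q_n`, which is the Hermite
recurrence after the factor `(-1) ^ n / n!`. -/
theorem scaledLaguerre_zero (n : ℕ) (t : ℝ) :
    scaledLaguerre n 0 t = (-1) ^ n * hermiteH n t / (n ! : ℝ) := by
  induction n using Nat.twoStepInduction with
  | zero => simp [scaledLaguerre, hermiteH_zero]
  | one => simp [scaledLaguerre, hermiteH_one]
  | more n h0 h1 =>
    have := Nat.factorial_ne_zero n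
    rw [scaledLaguerre, h0, h1, hermiteH_recurrence, Nat.factorial_succ (n + 1),
      Nat.factorial_succ n]
    push_cast
    field_simp
    ring

/-- Uniform subexponential growth of the rescaled Laguerre polynomials. -/
theorem exists_abs_scaledLaguerre_le (n : ℕ) :
    ∀ ε : ℝ, 0 < ε → ∃ C : ℝ, 0 < C ∧ ∀ s t : ℝ, 0 ≤ s → s ≤ 1 →
      |scaledLaguerre n s t| ≤ C * Real.exp (ε * |t|) := by
  have habs : ∀ ε : ℝ, 0 < ε → ∀ t : ℝ, |t| ≤ 1 / ε * Real.exp (ε * |t|) := fun ε hε t => by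
    have := Real.add_one_le_exp (ε * |t|)
    rw [div_mul_eq_mul_div, le_div_iff₀ hε]
    linarith
  have hsub : ∀ a b : ℝ, |a - b| ≤ |a| + |b| := fun a b => abs_sub a b
  have hone : ∀ ε : ℝ, 0 < ε → ∀ t : ℝ, 1 ≤ Real.exp (ε * |t|) := fun ε hε t =>
    Real.one_le_exp (by positivity)
  -- The quantifier over `ε` stays inside the induction: the linear factor in `t` consumes `ε / 2`,
  -- so the bound for `n + 1` is taken at rate `ε / 2`.
  induction n using Nat.twoStepInduction with
  | zero =>
    intro ε hε
    exact ⟨1, one_pos, fun s t _ _ => by simpa [scaledLaguerre] using hone ε hε t⟩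
  | one =>
    intro ε hε
    refine ⟨1 + 2 * (1 / ε), by positivity, fun s t hs hs1 => ?_⟩
    have h1 : |s - 2 * t| ≤ |s| + |2 * t| := hsub _ _
    rw [abs_of_nonneg hs, abs_mul, abs_two] at h1
    rw [scaledLaguerre]
    linarith [habs ε hε t, hone ε hε t]
  | more n h0 h1 =>
    intro ε hε
    obtain ⟨A, hA, hA'⟩ := h0 ε hε
    obtain ⟨B, hB, hB'⟩ := h1 (ε / 2) (by positivity)
    refine ⟨(2 * n + 3 + 2 * (1 / (ε / 2))) * B + (2 + (n + 1)) * A, by positivity,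
      fun s t hs hs1 => ?_⟩
    have hn : (0 : ℝ) ≤ n := n.cast_nonneg
    have e2 : Real.exp (ε * |t|) = Real.exp (ε / 2 * |t|) * Real.exp (ε / 2 * |t|) := by
      rw [← Real.exp_add]; ring_nf
    have hfac : |(2 * n + 3) * s - 2 * t|
        ≤ (2 * n + 3 + 2 * (1 / (ε / 2))) * Real.exp (ε / 2 * |t|) := by
      refine (hsub _ _).trans ?_
      rw [abs_mul, abs_mul, abs_two, abs_of_nonneg hs,
        abs_of_nonneg (by positivity : (0 : ℝ) ≤ 2 * n + 3),
        add_mul _ (2 * (1 / (ε / 2)))]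
      refine add_le_add ?_ ?_
      · exact mul_le_mul_of_nonneg_left (hs1.trans (hone _ (by positivity) t)) (by positivity)
      · rw [mul_assoc]
        exact mul_le_mul_of_nonneg_left (habs _ (by positivity) t) zero_le_two
    have hfac2 : |2 + (n + 1) * s ^ 2| ≤ 2 + ((n : ℝ) + 1) := by
      rw [abs_of_nonneg (by positivity)]
      have : s ^ 2 ≤ 1 := pow_le_one₀ hs hs1
      nlinarith
    rw [scaledLaguerre, abs_div, abs_of_pos (by positivity : (0 : ℝ) < n + 2)]
    refine (div_le_self (abs_nonneg _) (by linarith)).trans ((hsub _ _).trans ?_)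
    rw [abs_mul, abs_mul, add_mul (_ * B)]
    refine add_le_add ?_ ?_
    · calc _ ≤ (2 * n + 3 + 2 * (1 / (ε / 2))) * Real.exp (ε / 2 * |t|)
            * (B * Real.exp (ε / 2 * |t|)) :=
          mul_le_mul hfac (hB' s t hs hs1) (abs_nonneg _) (by positivity)
        _ = _ := by rw [e2]; ring
    · rw [mul_assoc]
      exact mul_le_mul hfac2 (hA' s t hs hs1) (abs_nonneg _) (by positivity)

/-! ### Laplace's method for the Laguerre weight -/

lemma log_one_add_le {u : ℝ} (hu : -1 < u) :
    Real.log (1 + u) ≤ u - u ^ 2 / (4 * (1 + |u|)) := by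
  have hp : 0 < 1 + u := by linarith
  have hsq : Real.sqrt (1 + u) ^ 2 = 1 + u := Real.sq_sqrt hp.le
  have hpos : 0 < Real.sqrt (1 + u) := Real.sqrt_pos.2 hp
  have hlog : Real.log (1 + u) = 2 * Real.log (Real.sqrt (1 + u)) := by
    rw [Real.log_sqrt hp.le]; ring
  have h1 := Real.log_le_sub_one_of_pos hpos
  -- From `log r ≤ r - 1` one gets `log (1 + u) ≤ 2 (r - 1) = u - (r - 1) ^ 2`. The gap is quadratic
  -- for small `u` and linear for large `u`, as the stated denominator records.
  set r := Real.sqrt (1 + u)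
  have hu' : u = (r - 1) * (r + 1) := by linarith
  have h2 : u ^ 2 / (4 * (1 + |u|)) ≤ (r - 1) ^ 2 := by
    rw [div_le_iff₀ (by positivity)]
    have : (r + 1) ^ 2 ≤ 4 * (1 + |u|) := by nlinarith [le_abs_self u, abs_nonneg u, sq_nonneg (r - 1)]
    calc u ^ 2 = (r - 1) ^ 2 * (r + 1) ^ 2 := by rw [hu']; ring
      _ ≤ _ := mul_le_mul_of_nonneg_left this (sq_nonneg _)
  nlinarith

/-- The logarithm of the weight `x ^ (α + δ) * exp (-x)` at `x = α (1 + s t)`, `α = 2 / s ^ 2`,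
relative to its size `(α / e) ^ α * α ^ δ`. -/
def logWeight (δ s t : ℝ) : ℝ := (2 / s ^ 2 + δ) * Real.log (1 + s * t) - 2 / s ^ 2 * (s * t)

/-- The terms linear in `t` cancel up to `δ s t`, which costs at most `|t| / 8`. Since `2 / s ^ 2 +
δ ≥ 1 / s ^ 2`, the gap in `log_one_add_le` gains at least `(|t| - 1) / 4`. -/
lemma logWeight_le {δ s t : ℝ} (hs : 0 < s) (hs1 : s ≤ 1) (hδ : 8 * |δ| * s ≤ 1)
    (ht : 0 < 1 + s * t) : logWeight δ s t ≤ 1 / 4 - |t| / 8 := by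
  have hlog := log_one_add_le (by linarith : -1 < s * t)
  have hsi : 1 ≤ 1 / s ^ 2 := by
    rw [le_div_iff₀ (by positivity), one_mul]; exact pow_le_one₀ hs.le hs1
  have hδ' : |δ| ≤ 1 / s ^ 2 := by
    rw [le_div_iff₀ (by positivity)]
    nlinarith [abs_nonneg δ, mul_nonneg (abs_nonneg δ) hs.le]
  have hge : 1 / s ^ 2 ≤ 2 / s ^ 2 + δ := by
    have : 2 / s ^ 2 = 1 / s ^ 2 + 1 / s ^ 2 := by ring
    linarith [neg_abs_le δ]
  have hst : |s * t| = s * |t| := by rw [abs_mul, abs_of_pos hs]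
  have hq : t ^ 2 / (4 * (1 + |t|)) ≤ 1 / s ^ 2 * ((s * t) ^ 2 / (4 * (1 + |s * t|))) := by
    have : 1 / s ^ 2 * ((s * t) ^ 2 / (4 * (1 + |s * t|))) = t ^ 2 / (4 * (1 + s * |t|)) := by
      rw [hst]; field_simp
    rw [this]
    gcongr
    nlinarith [abs_nonneg t]
  have hq2 : (|t| - 1) / 4 ≤ t ^ 2 / (4 * (1 + |t|)) := by
    rw [le_div_iff₀ (by positivity), ← sq_abs t]
    nlinarith [abs_nonneg t]
  have hq3 : 1 / s ^ 2 * ((s * t) ^ 2 / (4 * (1 + |s * t|)))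
      ≤ (2 / s ^ 2 + δ) * ((s * t) ^ 2 / (4 * (1 + |s * t|))) :=
    mul_le_mul_of_nonneg_right hge (by positivity)
  have hd : δ * (s * t) ≤ |t| / 8 := by
    calc δ * (s * t) ≤ |δ * (s * t)| := le_abs_self _
      _ = |δ| * s * |t| := by rw [abs_mul, hst]; ring
      _ ≤ 1 / 8 * |t| := mul_le_mul_of_nonneg_right (by linarith) (abs_nonneg t)
      _ = _ := by ring
  have hm := mul_le_mul_of_nonneg_left hlog
    ((by positivity : (0 : ℝ) ≤ 1 / s ^ 2).trans hge)
  rw [logWeight]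
  linarith

lemma tendsto_logWeight (δ t : ℝ) :
    Tendsto (fun s => logWeight δ s t) (𝓝[>] 0) (𝓝 (-t ^ 2)) := by
  have hc : Tendsto (fun s : ℝ => s * t) (𝓝[>] 0) (𝓝 0) :=
    ((continuous_mul_const t).tendsto' 0 0 (zero_mul t)).mono_left nhdsWithin_le_nhds
  have hδ : Tendsto (fun s : ℝ => δ * Real.log (1 + s * t)) (𝓝[>] 0) (𝓝 0) := by
    have : Tendsto (fun u : ℝ => δ * Real.log (1 + u)) (𝓝 0) (𝓝 0) := by
      have h : ContinuousAt (fun u : ℝ => δ * Real.log (1 + u)) 0 := by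
        refine continuousAt_const.mul (ContinuousAt.log (by fun_prop) (by norm_num))
      simpa [ContinuousAt] using h
    exact this.comp hc
  have hmain : Tendsto (fun s : ℝ => 2 / s ^ 2 * (Real.log (1 + s * t) - s * t)) (𝓝[>] 0)
      (𝓝 (-t ^ 2)) := by
    have hb : Tendsto (fun s : ℝ => 2 * |s * t| * t ^ 2 / (1 - |s * t|)) (𝓝[>] 0) (𝓝 0) := by
      have h : ContinuousAt (fun u : ℝ => 2 * |u| * t ^ 2 / (1 - |u|)) 0 := by
        refine ContinuousAt.div (by fun_prop) (by fun_prop) (by simp)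
      have h' : Tendsto (fun u : ℝ => 2 * |u| * t ^ 2 / (1 - |u|)) (𝓝 0) (𝓝 0) := by
        simpa [ContinuousAt] using h
      exact h'.comp hc
    rw [tendsto_iff_norm_sub_tendsto_zero]
    refine squeeze_zero' (Eventually.of_forall fun _ => norm_nonneg _) ?_ hb
    have hsmall : ∀ᶠ s in 𝓝[>] (0 : ℝ), |s * t| < 1 := by
      have := (hc.abs).eventually (gt_mem_nhds (by simp : |(0 : ℝ)| < 1))
      exact this
    filter_upwards [hsmall, self_mem_nhdsWithin] with s hs hs0
    have hs0 : 0 < s := hs0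
    -- Second-order Taylor remainder of `log (1 + s t)`: it is cubic in `s t`, so the prefactor `2 /
    -- s ^ 2` leaves an error of order `s`.
    have h := Real.abs_log_sub_add_sum_range_le (x := -(s * t)) (by rwa [abs_neg]) 2
    rw [abs_neg, sub_neg_eq_add] at h
    simp only [Finset.sum_range_succ, Finset.sum_range_zero] at h
    norm_num at h
    have e : 2 / s ^ 2 * (Real.log (1 + s * t) - s * t) - -t ^ 2
        = 2 / s ^ 2 * (-(s * t) + (s * t) ^ 2 / 2 + Real.log (1 + s * t)) := by
      field_simp; ring
    rw [e, Real.norm_eq_abs, abs_mul, abs_of_pos (by positivity : 0 < 2 / s ^ 2)]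
    have hden : 0 < 1 - |s * t| := by linarith
    calc _ ≤ 2 / s ^ 2 * (|s * t| ^ 3 / (1 - |s * t|)) := by gcongr; rwa [abs_mul]
      _ = 2 * |s * t| * t ^ 2 / (1 - |s * t|) := by
        rw [pow_succ |s * t| 2, sq_abs]
        field_simp
  have := hmain.add hδ
  rw [add_zero] at this
  refine this.congr fun s => ?_
  rw [logWeight]; ring

lemma integrable_exp_neg_mul_abs {b : ℝ} (hb : 0 < b) :
    Integrable fun t : ℝ => Real.exp (-b * |t|) := by
  rw [← integrableOn_univ, ← Set.Iic_union_Ioi (a := (0 : ℝ)), integrableOn_union]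
  constructor
  · refine (integrableOn_exp_mul_Iic hb 0).congr_fun (fun t ht => ?_) measurableSet_Iic
    simp [abs_of_nonpos (Set.mem_Iic.1 ht)]
  · refine (integrableOn_exp_mul_Ioi (neg_lt_zero.2 hb) 0).congr_fun (fun t ht => ?_)
      measurableSet_Ioi
    simp [abs_of_pos (Set.mem_Ioi.1 ht)]

lemma tendsto_sqrt_two_div : Tendsto (fun α : ℝ => Real.sqrt (2 / α)) atTop (𝓝[>] 0) := by
  rw [tendsto_nhdsWithin_iff]
  constructor
  · have h : Tendsto (fun α : ℝ => 2 / α) atTop (𝓝 0) := tendsto_const_nhds.div_atTop tendsto_id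
    have := (Real.continuous_sqrt.tendsto 0).comp h
    rwa [Real.sqrt_zero] at this
  · filter_upwards [eventually_gt_atTop 0] with α hα
    exact Real.sqrt_pos.2 (by positivity)

lemma two_div_sqrt_two_div_sq {α : ℝ} (hα : 0 < α) : 2 / Real.sqrt (2 / α) ^ 2 = α := by
  rw [Real.sq_sqrt (by positivity)]; field_simp

/-- The affine substitution `x = α (1 + s t)`, `s = √(2 / α)`. -/
lemma integral_Ioi_eq_integral_scaled {α : ℝ} (hα : 0 < α) (δ : ℝ) (f : ℝ → ℝ) :
    (∫ x in Set.Ioi (0 : ℝ), x ^ (α + δ) * Real.exp (-x) * f x) =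
      (α / Real.exp 1) ^ α * α ^ (δ + 1 / 2) * (Real.sqrt 2 *
        ∫ t, Set.indicator {t | 0 < 1 + Real.sqrt (2 / α) * t}
          (fun t => Real.exp (logWeight δ (Real.sqrt (2 / α)) t)
            * f (α + α * Real.sqrt (2 / α) * t)) t) := by
  set s := Real.sqrt (2 / α) with hsdef
  have hs : 0 < s := Real.sqrt_pos.2 (by positivity)
  have hs2 : 2 / s ^ 2 = α := two_div_sqrt_two_div_sq hα
  -- The Jacobian of the substitution; it supplies the extra `α ^ (1/2)` and the `√2`.
  have hαs : α * s = α ^ (1 / 2 : ℝ) * Real.sqrt 2 := by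
    rw [hsdef, Real.sqrt_div' _ hα.le, ← Real.sqrt_eq_rpow]
    have : Real.sqrt α ≠ 0 := (Real.sqrt_pos.2 hα).ne'
    field_simp
    rw [Real.sq_sqrt hα.le]
  rw [← integral_indicator measurableSet_Ioi,
    ← integral_add_left_eq_self _ α]
  have h := Measure.integral_comp_mul_left (fun y => Set.indicator (Set.Ioi 0)
    (fun x => x ^ (α + δ) * Real.exp (-x) * f x) (α + y)) (α * s)
  rw [abs_of_pos (by positivity), smul_eq_mul, eq_inv_mul_iff_mul_eq₀ (by positivity)] at h
  rw [← h, Real.rpow_add hα]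
  have hpt : ∀ t, Set.indicator (Set.Ioi 0) (fun x => x ^ (α + δ) * Real.exp (-x) * f x)
      (α + α * s * t) = (α / Real.exp 1) ^ α * α ^ δ *
        Set.indicator {t | 0 < 1 + s * t}
          (fun t => Real.exp (logWeight δ s t) * f (α + α * s * t)) t := by
    intro t
    have hx : α + α * s * t = α * (1 + s * t) := by ring
    by_cases ht : 0 < 1 + s * t
    · rw [Set.indicator_of_mem (by rw [hx]; exact mul_pos hα ht),
        Set.indicator_of_mem (show t ∈ {t | 0 < 1 + s * t} from ht), ← mul_assoc]
      congr 1
      rw [hx, logWeight, hs2, Real.rpow_def_of_pos (mul_pos hα ht),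
        Real.rpow_def_of_pos (div_pos hα (Real.exp_pos 1)), Real.rpow_def_of_pos hα,
        Real.log_mul hα.ne' ht.ne', Real.log_div hα.ne' (Real.exp_pos 1).ne', Real.log_exp,
        ← Real.exp_add, ← Real.exp_add, ← Real.exp_add]
      congr 1
      ring
    · rw [Set.indicator_of_notMem (by rw [hx, Set.mem_Ioi, mul_pos_iff_of_pos_left hα]; exact ht),
        Set.indicator_of_notMem (show t ∉ {t | 0 < 1 + s * t} from ht), mul_zero]
  simp only [hpt]
  rw [integral_const_mul]
  generalize (∫ t : ℝ, _ : ℝ) = I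
  linear_combination ((α / Real.exp 1) ^ α * α ^ δ * I) * hαs

/-- Laplace's method for the weight `x ^ (α + δ) * exp (-x)` as `α → ∞`. -/
theorem tendsto_integral_rpow_mul_exp_neg (δ C : ℝ) (F : ℝ → ℝ → ℝ) (g : ℝ → ℝ)
    (hmeas : ∀ α, Measurable (F α))
    (hlim : ∀ t, Tendsto (fun α => F α (α + α * Real.sqrt (2 / α) * t)) atTop (𝓝 (g t)))
    (hbound : ∀ᶠ α in atTop, ∀ t,
      |F α (α + α * Real.sqrt (2 / α) * t)| ≤ C * Real.exp (1 / 16 * |t|)) :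
    Tendsto (fun α => (∫ x in Set.Ioi (0 : ℝ), x ^ (α + δ) * Real.exp (-x) * F α x) /
      ((α / Real.exp 1) ^ α * α ^ (δ + 1 / 2))) atTop
      (𝓝 (Real.sqrt 2 * ∫ t, Real.exp (-t ^ 2) * g t)) := by
  have hs := tendsto_sqrt_two_div
  have hs0 : Tendsto (fun α : ℝ => Real.sqrt (2 / α)) atTop (𝓝 0) :=
    hs.mono_right nhdsWithin_le_nhds
  have hev1 : ∀ᶠ α : ℝ in atTop, Real.sqrt (2 / α) ≤ 1 :=
    hs0.eventually (ge_mem_nhds one_pos)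
  have hevδ : ∀ᶠ α : ℝ in atTop, 8 * |δ| * Real.sqrt (2 / α) ≤ 1 := by
    have := hs0.const_mul (8 * |δ|)
    rw [mul_zero] at this
    exact this.eventually (ge_mem_nhds one_pos)
  have hDCT : Tendsto (fun α : ℝ => ∫ t, Set.indicator {t | 0 < 1 + Real.sqrt (2 / α) * t}
          (fun t => Real.exp (logWeight δ (Real.sqrt (2 / α)) t)
            * F α (α + α * Real.sqrt (2 / α) * t)) t) atTop
        (𝓝 (∫ t, Real.exp (-t ^ 2) * g t)) := by
    refine tendsto_integral_filter_of_dominated_convergence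
      -- The weight gives `exp (1/4 - |t|/8)` and `F` at most `C * exp (|t|/16)`, leaving decay at
      -- rate `1/16`.
      (fun t => C * Real.exp (1 / 4) * Real.exp (-(1 / 16) * |t|)) ?_ ?_ ?_ ?_
    · refine Eventually.of_forall fun α => ?_
      refine (Measurable.indicator ?_ ?_).aestronglyMeasurable
      · unfold logWeight
        exact (by fun_prop : Measurable fun t => Real.exp ((2 / Real.sqrt (2 / α) ^ 2 + δ)
          * Real.log (1 + Real.sqrt (2 / α) * t) - 2 / Real.sqrt (2 / α) ^ 2
            * (Real.sqrt (2 / α) * t))).mul ((hmeas α).comp (by fun_prop))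
      · exact measurableSet_lt measurable_const (by fun_prop)
    · filter_upwards [hev1, hevδ, hbound, eventually_gt_atTop 0] with α h1 hδ hb hα
      refine Eventually.of_forall fun t => ?_
      have hC : 0 ≤ C * Real.exp (1 / 16 * |t|) := (abs_nonneg _).trans (hb t)
      have hC' : 0 ≤ C := nonneg_of_mul_nonneg_left hC (Real.exp_pos _)
      by_cases ht : 0 < 1 + Real.sqrt (2 / α) * t
      · rw [Set.indicator_of_mem (by exact ht), norm_mul, Real.norm_eq_abs, Real.norm_eq_abs,
          Real.abs_exp]
        calc _ ≤ Real.exp (1 / 4 - |t| / 8) * (C * Real.exp (1 / 16 * |t|)) := by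
              refine mul_le_mul (Real.exp_le_exp.2 ?_) (hb t) (abs_nonneg _) (Real.exp_pos _).le
              exact logWeight_le (Real.sqrt_pos.2 (by positivity)) h1 hδ ht
          _ = C * (Real.exp (1 / 4 - |t| / 8) * Real.exp (1 / 16 * |t|)) := by ring
          _ = C * Real.exp (1 / 4) * Real.exp (-(1 / 16) * |t|) := by
              rw [mul_assoc, ← Real.exp_add, ← Real.exp_add]; ring_nf
      · rw [Set.indicator_of_notMem (by exact ht), norm_zero]
        positivity
    · exact (integrable_exp_neg_mul_abs (by norm_num)).const_mul _
    · refine Eventually.of_forall fun t => ?_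
      have hpos : ∀ᶠ α : ℝ in atTop, 0 < 1 + Real.sqrt (2 / α) * t := by
        have := (hs0.mul_const t).const_add 1
        rw [zero_mul, add_zero] at this
        exact this.eventually (lt_mem_nhds one_pos)
      have hw : Tendsto (fun α => Real.exp (logWeight δ (Real.sqrt (2 / α)) t)
          * F α (α + α * Real.sqrt (2 / α) * t)) atTop (𝓝 (Real.exp (-t ^ 2) * g t)) :=
        ((Real.continuous_exp.tendsto _).comp ((tendsto_logWeight δ t).comp hs)).mul (hlim t)
      refine hw.congr' ?_
      filter_upwards [hpos] with α hα
      rw [Set.indicator_of_mem (by exact hα)]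
  refine (hDCT.const_mul (Real.sqrt 2)).congr' ?_
  filter_upwards [eventually_gt_atTop 0] with α hα
  have : (α / Real.exp 1) ^ α * α ^ (δ + 1 / 2) ≠ 0 :=
    mul_ne_zero (Real.rpow_pos_of_pos (by positivity) _).ne' (Real.rpow_pos_of_pos hα _).ne'
  rw [integral_Ioi_eq_integral_scaled hα, mul_div_cancel_left₀ _ this]

/-! ### Hermite integrals: convergence, squared norm, positivity -/

lemma integrable_mul_hermiteWeight {f : ℝ → ℝ} {C : ℝ} (hf : Measurable f)
    (hb : ∀ t, |f t| ≤ C * Real.exp (1 / 2 * |t|)) :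
    Integrable fun t => f t * hermiteWeight t := by
  refine ((integrable_exp_neg_mul_abs (b := 1 / 2) (by norm_num)).const_mul
    (C * Real.exp (1 / 4))).mono' ?_ (Eventually.of_forall fun t => ?_)
  · unfold hermiteWeight
    exact (hf.mul (by fun_prop)).aestronglyMeasurable
  · have hC : 0 ≤ C * Real.exp (1 / 2 * |t|) := (abs_nonneg _).trans (hb t)
    rw [norm_mul, Real.norm_eq_abs, Real.norm_eq_abs, hermiteWeight, Real.abs_exp]
    have h : Real.exp (-t ^ 2) ≤ Real.exp (1 / 4 - |t|) := by
      rw [Real.exp_le_exp, ← sq_abs t]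
      nlinarith [sq_nonneg (|t| - 1 / 2)]
    calc _ ≤ C * Real.exp (1 / 2 * |t|) * Real.exp (1 / 4 - |t|) :=
          mul_le_mul (hb t) h (Real.exp_pos _).le hC
      _ = _ := by rw [mul_assoc, mul_assoc, ← Real.exp_add, ← Real.exp_add]; ring_nf

/-- The case `s = 0` of the uniform bound. -/
lemma exists_abs_hermiteH_le (n : ℕ) {ε : ℝ} (hε : 0 < ε) :
    ∃ C : ℝ, 0 < C ∧ ∀ t, |hermiteH n t| ≤ C * Real.exp (ε * |t|) := by
  obtain ⟨C, hC, h⟩ := exists_abs_scaledLaguerre_le n ε hε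
  have hn : (0 : ℝ) < n ! := by positivity
  refine ⟨n ! * C, by positivity, fun t => ?_⟩
  have := h 0 t le_rfl zero_le_one
  rw [scaledLaguerre_zero, abs_div, abs_mul, abs_pow, abs_neg, abs_one, one_pow, one_mul,
    abs_of_pos hn, div_le_iff₀ hn] at this
  linarith

lemma integrable_hermiteH_mul_hermiteH (m n : ℕ) :
    Integrable fun t => hermiteH m t * hermiteH n t * hermiteWeight t := by
  obtain ⟨A, hA, hA'⟩ := exists_abs_hermiteH_le m (ε := 1 / 4) (by norm_num)
  obtain ⟨B, hB, hB'⟩ := exists_abs_hermiteH_le n (ε := 1 / 4) (by norm_num)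
  refine integrable_mul_hermiteWeight (C := A * B)
    ((continuous_hermiteH m).mul (continuous_hermiteH n)).measurable fun t => ?_
  rw [abs_mul]
  refine (mul_le_mul (hA' t) (hB' t) (abs_nonneg _) (by positivity)).trans_eq ?_
  rw [mul_mul_mul_comm, ← Real.exp_add]
  ring_nf

lemma abs_rpow_le_of_abs_le_exp {a C ε q y : ℝ} (hq : 0 < q) (hC : 0 < C)
    (h : |a| ≤ C * Real.exp (ε / q * y)) : |a| ^ q ≤ C ^ q * Real.exp (ε * y) := by
  refine (Real.rpow_le_rpow (abs_nonneg _) h hq.le).trans_eq ?_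
  rw [Real.mul_rpow hC.le (Real.exp_pos _).le, ← Real.exp_mul]
  congr 2
  field_simp

theorem integrable_abs_hermiteH_rpow (m : ℕ) {q : ℝ} (hq : 0 < q) :
    Integrable fun t => |hermiteH m t| ^ q * hermiteWeight t := by
  obtain ⟨C, hC, h⟩ := exists_abs_hermiteH_le m (ε := 1 / 2 / q) (by positivity)
  refine integrable_mul_hermiteWeight (C := C ^ q)
    ((continuous_hermiteH m).abs.measurable.pow_const q) fun t => ?_
  rw [abs_of_nonneg (by positivity)]
  exact abs_rpow_le_of_abs_le_exp hq hC (h t)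

/-- The squared norm of the Hermite polynomials. -/
theorem integral_hermiteH_sq (n : ℕ) :
    ∫ t, hermiteH n t * hermiteH n t * hermiteWeight t = Real.sqrt Real.pi * 2 ^ n * n ! := by
  induction n with
  | zero =>
    have := integral_gaussian 1
    simpa [hermiteH_zero, hermiteWeight] using this
  | succ n ih =>
    -- `H_{n+1} w = -(H_n w)'`, so integrating by parts moves the derivative onto the other
    -- `H_{n+1}` and lowers the degree.
    have hv : ∀ t, HasDerivAt (fun t => -(hermiteH n t * hermiteWeight t))
        (hermiteH (n + 1) t * hermiteWeight t) t := fun t => by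
      have hw : HasDerivAt hermiteWeight (hermiteWeight t * (-(2 * t))) t := by
        have := ((hasDerivAt_pow 2 t).neg).exp
        refine this.congr_deriv ?_
        simp [hermiteWeight]
      refine (((hasDerivAt_hermiteH n t).mul hw).neg).congr_deriv ?_
      ring
    have hparts := integral_mul_deriv_eq_deriv_mul_of_integrable
      (fun t _ => hasDerivAt_hermiteH_succ n t) (fun t _ => hv t)
      (((integrable_hermiteH_mul_hermiteH (n + 1) (n + 1))).congr
        (Eventually.of_forall fun t => by simp only [Pi.mul_apply]; ring))
      (((integrable_hermiteH_mul_hermiteH n n).const_mul (-(2 * ((n : ℝ) + 1)))).congr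
        (Eventually.of_forall fun t => by simp only [Pi.mul_apply]; ring))
      (((integrable_hermiteH_mul_hermiteH (n + 1) n).neg).congr
        (Eventually.of_forall fun t => by simp only [Pi.mul_apply, Pi.neg_apply]; ring))
    have h1 : ∫ t, hermiteH (n + 1) t * hermiteH (n + 1) t * hermiteWeight t
        = ∫ t, hermiteH (n + 1) t * (hermiteH (n + 1) t * hermiteWeight t) := by
      simp only [mul_assoc]
    have h2 : ∫ t, 2 * ((n : ℝ) + 1) * hermiteH n t * -(hermiteH n t * hermiteWeight t)
        = -(2 * ((n : ℝ) + 1)) * ∫ t, hermiteH n t * hermiteH n t * hermiteWeight t := by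
      rw [← integral_const_mul]
      exact integral_congr_ae (Eventually.of_forall fun t => by ring)
    rw [h1, hparts, h2, ih, Nat.factorial_succ]
    push_cast
    ring

/-- A nonzero limit is needed to pass from convergence of a quotient to `~`. The squared norm shows
that `H_m` is not identically zero, so its nonvanishing set is open and nonempty. -/
lemma normHermite_pos (m : ℕ) {q : ℝ} (hq : 0 < q) : 0 < normHermite q m := by
  have hw : ∀ t, 0 < hermiteWeight t := fun t => Real.exp_pos _
  rw [normHermite, unweightedNorm, setIntegral_univ, integral_pos_iff_support_of_nonneg
    (fun t => mul_nonneg (by positivity) (hw t).le) (integrable_abs_hermiteH_rpow m hq)]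
  have hsupp : (Function.support fun t => |hermiteH m t| ^ q * hermiteWeight t)
      = {t | hermiteH m t ≠ 0} := by
    ext t
    simp [(hw t).ne', Real.rpow_eq_zero (abs_nonneg _) hq.ne']
  rw [hsupp]
  refine (isOpen_ne_fun (continuous_hermiteH m) continuous_const).measure_pos _ ?_
  by_contra hne
  have h0 : ∀ t, hermiteH m t = 0 := fun t => by
    by_contra ht
    exact hne ⟨t, ht⟩
  have h := integral_hermiteH_sq m
  simp only [h0, zero_mul, integral_zero] at h
  have : 0 < Real.sqrt Real.pi := Real.sqrt_pos.2 Real.pi_pos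
  have : 0 < Real.sqrt Real.pi * 2 ^ m * (m ! : ℝ) := by positivity
  linarith

lemma normHermite_two (m : ℕ) : normHermite 2 m = Real.sqrt Real.pi * 2 ^ m * m ! := by
  rw [normHermite, unweightedNorm, setIntegral_univ, ← integral_hermiteH_sq]
  refine integral_congr_ae (Eventually.of_forall fun t => ?_)
  simp only [Real.rpow_two, sq_abs]
  ring

/-! ### Convergence of the Laguerre integrals -/

lemma exists_abs_laguerreL_le (m : ℕ) (α : ℝ) {ε : ℝ} (hε : 0 < ε) :
    ∃ C : ℝ, 0 < C ∧ ∀ x, 0 < x → |laguerreL m α x| ≤ C * Real.exp (ε * x) := by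
  refine ⟨1 + ∑ k ∈ Finset.range (m + 1), |laguerreCoeff α m k| * (k ! / ε ^ k), ?_,
    fun x hx => ?_⟩
  · have : 0 ≤ ∑ k ∈ Finset.range (m + 1), |laguerreCoeff α m k| * (k ! / ε ^ k) :=
      Finset.sum_nonneg fun k _ => by positivity
    linarith
  · rw [laguerreL_eq_sum_coeff α x (Nat.lt_succ_self m)]
    refine (Finset.abs_sum_le_sum_abs _ _).trans ?_
    rw [add_mul, Finset.sum_mul]
    refine le_add_of_nonneg_of_le (by positivity) (Finset.sum_le_sum fun k _ => ?_)
    rw [abs_mul, mul_assoc]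
    refine mul_le_mul_of_nonneg_left ?_ (abs_nonneg _)
    have h := Real.pow_div_factorial_le_exp (ε * x) (by positivity) k
    rw [abs_of_pos (by positivity)]
    calc x ^ k = k ! / ε ^ k * ((ε * x) ^ k / k !) := by
          rw [mul_pow]; field_simp
      _ ≤ _ := mul_le_mul_of_nonneg_left h (by positivity)

lemma integrableOn_rpow_mul_exp_neg_mul {β C : ℝ} (hβ : -1 < β) {f : ℝ → ℝ} (hf : Measurable f)
    (hb : ∀ x, 0 < x → |f x| ≤ C * Real.exp (1 / 2 * x)) :
    IntegrableOn (fun x => x ^ β * Real.exp (-x) * f x) (Set.Ioi 0) := by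
  have h := (integrableOn_rpow_mul_exp_neg_mul_rpow hβ one_pos
    (by norm_num : (0 : ℝ) < 1 / 2)).const_mul C
  refine h.mono' ((Measurable.mul (by fun_prop) hf).aestronglyMeasurable) ?_
  refine (ae_restrict_iff' measurableSet_Ioi).2 (Eventually.of_forall fun x hx => ?_)
  have hx : 0 < x := hx
  rw [norm_mul, Real.norm_eq_abs, Real.norm_eq_abs, abs_of_pos (by positivity), Real.rpow_one]
  calc _ ≤ x ^ β * Real.exp (-x) * (C * Real.exp (1 / 2 * x)) :=
        mul_le_mul_of_nonneg_left (hb x hx) (by positivity)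
    _ = C * (x ^ β * (Real.exp (-x) * Real.exp (1 / 2 * x))) := by ring
    _ = _ := by rw [← Real.exp_add]; ring_nf

theorem integrableOn_abs_laguerreL_rpow (m : ℕ) (α : ℝ) {β q : ℝ} (hβ : -1 < β) (hq : 0 < q) :
    IntegrableOn (fun x => x ^ β * Real.exp (-x) * |laguerreL m α x| ^ q) (Set.Ioi 0) := by
  obtain ⟨C, hC, h⟩ := exists_abs_laguerreL_le m α (ε := 1 / 2 / q) (by positivity)
  refine integrableOn_rpow_mul_exp_neg_mul (C := C ^ q) hβ
    ((continuous_laguerreL m α).abs.measurable.pow_const q) fun x hx => ?_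
  rw [abs_of_nonneg (by positivity)]
  exact abs_rpow_le_of_abs_le_exp hq hC (h x hx)

/-- Absorbs the logarithmic singularity at the zeros of the polynomial, via `1 - 1/y ≤ log y ≤ y -
1`; at `y = 0` the convention `log 0 = 0` applies. -/
lemma abs_mul_log_le {y : ℝ} (hy : 0 ≤ y) : |y * Real.log y| ≤ 1 + y ^ 2 := by
  rcases hy.eq_or_lt with rfl | hy
  · simp
  · have h1 := Real.log_le_sub_one_of_pos hy
    have h2 := Real.one_sub_inv_le_log_of_pos hy
    have h3 : y * (1 - y⁻¹) = y - 1 := by field_simp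
    rw [abs_le]
    constructor <;> nlinarith [mul_le_mul_of_nonneg_left h2 hy.le]

lemma one_add_pow_four_le {a C ε y : ℝ} (hε : 0 < ε) (hy : 0 ≤ y)
    (h : |a| ≤ C * Real.exp (ε * y)) : 1 + (a ^ 2) ^ 2 ≤ (1 + C ^ 4) * Real.exp (4 * ε * y) := by
  have h4 : (a ^ 2) ^ 2 ≤ C ^ 4 * Real.exp (4 * ε * y) := by
    calc (a ^ 2) ^ 2 = |a| ^ 4 := by rw [← sq_abs a]; ring
      _ ≤ (C * Real.exp (ε * y)) ^ 4 := pow_le_pow_left₀ (abs_nonneg _) h 4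
      _ = _ := by rw [mul_pow, ← Real.exp_nat_mul]; push_cast; ring_nf
  have : 1 ≤ Real.exp (4 * ε * y) := Real.one_le_exp (by positivity)
  linarith

theorem integrableOn_laguerreL_sq_mul_log (m : ℕ) (α : ℝ) {β : ℝ} (hβ : -1 < β) :
    IntegrableOn (fun x => x ^ β * Real.exp (-x) * |laguerreL m α x| ^ 2 *
      Real.log (|laguerreL m α x| ^ 2)) (Set.Ioi 0) := by
  obtain ⟨C, hC, h⟩ := exists_abs_laguerreL_le m α (ε := 1 / 8) (by positivity)
  have hm : Measurable (laguerreL m α) := (continuous_laguerreL m α).measurable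
  simp only [mul_assoc (_ * _) (|laguerreL m α _| ^ 2)]
  refine integrableOn_rpow_mul_exp_neg_mul (C := 1 + C ^ 4) hβ
    ((hm.abs.pow_const 2).mul (Real.measurable_log.comp (hm.abs.pow_const 2))) fun x hx => ?_
  refine (abs_mul_log_le (by positivity)).trans ?_
  rw [sq_abs]
  refine (one_add_pow_four_le (by norm_num) hx.le (h x hx)).trans_eq ?_
  norm_num

/-! ### Asymptotics of the power integrals -/

lemma tendsto_scaledLaguerre (m : ℕ) (t : ℝ) :
    Tendsto (fun α => scaledLaguerre m (Real.sqrt (2 / α)) t) atTop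
      (𝓝 ((-1) ^ m * hermiteH m t / (m ! : ℝ))) := by
  rw [← scaledLaguerre_zero]
  have h : Continuous fun s => scaledLaguerre m s t :=
    (continuous_scaledLaguerre m).comp (by fun_prop : Continuous fun s : ℝ => (s, t))
  exact (h.tendsto 0).comp (tendsto_sqrt_two_div.mono_right nhdsWithin_le_nhds)

lemma scaledLaguerre_sqrt_two_div (m : ℕ) {α : ℝ} (hα : 0 < α) (t : ℝ) :
    Real.sqrt (2 / α) ^ m * laguerreL m α (α + α * Real.sqrt (2 / α) * t) =
      scaledLaguerre m (Real.sqrt (2 / α)) t := by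
  have hs : 0 < Real.sqrt (2 / α) := Real.sqrt_pos.2 (by positivity)
  have h2 : 2 / Real.sqrt (2 / α) ^ 2 = α := two_div_sqrt_two_div_sq hα
  have h3 : 2 * t / Real.sqrt (2 / α) = 2 / Real.sqrt (2 / α) ^ 2 * Real.sqrt (2 / α) * t := by
    field_simp
  rw [scaledLaguerre_eq m hs.ne', h3, h2]

lemma eventually_sqrt_two_div_le_one : ∀ᶠ α : ℝ in atTop, Real.sqrt (2 / α) ≤ 1 :=
  (tendsto_sqrt_two_div.mono_right nhdsWithin_le_nhds).eventually (ge_mem_nhds one_pos)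

lemma tendsto_integral_scaled_abs_rpow (m : ℕ) (δ : ℝ) {q : ℝ} (hq : 0 < q) :
    Tendsto (fun α => (∫ x in Set.Ioi (0 : ℝ), x ^ (α + δ) * Real.exp (-x) *
        |Real.sqrt (2 / α) ^ m * laguerreL m α x| ^ q) /
      ((α / Real.exp 1) ^ α * α ^ (δ + 1 / 2))) atTop
      (𝓝 (Real.sqrt 2 * (normHermite q m / (m ! : ℝ) ^ q))) := by
  obtain ⟨C, hC, h⟩ := exists_abs_scaledLaguerre_le m (1 / 16 / q) (by positivity)
  have key := tendsto_integral_rpow_mul_exp_neg δ (C ^ q)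
    (fun α x => |Real.sqrt (2 / α) ^ m * laguerreL m α x| ^ q)
    (fun t => |hermiteH m t| ^ q / (m ! : ℝ) ^ q)
    (fun α => (((continuous_laguerreL m α).measurable.const_mul _).abs.pow_const q)) ?_ ?_
  · convert key using 3
    rw [normHermite, unweightedNorm, setIntegral_univ, ← integral_div]
    refine integral_congr_ae (Eventually.of_forall fun t => ?_)
    simp only [hermiteWeight]
    ring
  · intro t
    have h1 := ((tendsto_scaledLaguerre m t).abs).rpow_const (p := q) (Or.inr hq.le)
    rw [abs_div, abs_mul, abs_pow, abs_neg, abs_one, one_pow, one_mul,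
      abs_of_pos (by positivity : (0 : ℝ) < m !),
      Real.div_rpow (abs_nonneg _) (by positivity)] at h1
    refine h1.congr' ?_
    filter_upwards [eventually_gt_atTop 0] with α hα
    rw [scaledLaguerre_sqrt_two_div m hα]
  · filter_upwards [eventually_gt_atTop 0, eventually_sqrt_two_div_le_one] with α hα hs1 t
    rw [scaledLaguerre_sqrt_two_div m hα, abs_of_nonneg (by positivity)]
    exact abs_rpow_le_of_abs_le_exp hq hC (h _ t (Real.sqrt_nonneg _) hs1)

theorem isEquivalent_integral_abs_laguerreL_rpow (m : ℕ) (δ : ℝ) {q : ℝ} (hq : 0 < q) :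
    (fun α : ℝ => ∫ x in Set.Ioi (0 : ℝ),
          x ^ (α + δ) * Real.exp (-x) * |laguerreL m α x| ^ q) ~[atTop]
        (fun α : ℝ => constC m q * (α / Real.exp 1) ^ α * α ^ (δ + ((m : ℝ) * q + 1) / 2)) := by
  have hN := normHermite_pos m hq
  have hlim := (isEquivalent_const_iff_tendsto (by positivity)).2
    (tendsto_integral_scaled_abs_rpow m δ hq)
  -- The factor `(α/2) ^ (mq/2)` undoes the normalisation `s ^ (mq)`.
  have hmul := hlim.mul (IsEquivalent.refl (u := fun α : ℝ => (α / 2) ^ ((m : ℝ) * q / 2) *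
    ((α / Real.exp 1) ^ α * α ^ (δ + 1 / 2))))
  refine (hmul.congr_left ?_).congr_right ?_
  · filter_upwards [eventually_gt_atTop 0] with α hα
    have hA : 0 < (α / Real.exp 1) ^ α * α ^ (δ + 1 / 2) := by positivity
    have hs : 0 < Real.sqrt (2 / α) := Real.sqrt_pos.2 (by positivity)
    have hsq : (Real.sqrt (2 / α) ^ m) ^ q = ((α / 2) ^ ((m : ℝ) * q / 2))⁻¹ := by
      rw [← Real.rpow_natCast, ← Real.rpow_mul (Real.sqrt_nonneg _), Real.sqrt_eq_rpow,
        ← Real.rpow_mul (by positivity), ← Real.inv_rpow (by positivity), inv_div]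
      congr 1
      ring
    have hI : (∫ x in Set.Ioi (0 : ℝ), x ^ (α + δ) * Real.exp (-x) *
        |Real.sqrt (2 / α) ^ m * laguerreL m α x| ^ q) = ((α / 2) ^ ((m : ℝ) * q / 2))⁻¹ *
        ∫ x in Set.Ioi (0 : ℝ), x ^ (α + δ) * Real.exp (-x) * |laguerreL m α x| ^ q := by
      rw [← integral_const_mul]
      refine integral_congr_ae (Eventually.of_forall fun x => ?_)
      simp only [abs_mul, Real.mul_rpow (abs_nonneg _) (abs_nonneg _)]
      rw [abs_of_pos (by positivity : 0 < Real.sqrt (2 / α) ^ m), hsq]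
      ring
    have hB : (α / 2) ^ ((m : ℝ) * q / 2) ≠ 0 := by positivity
    simp only [Pi.mul_apply]
    rw [hI]
    field_simp
  · filter_upwards [eventually_gt_atTop 0] with α hα
    simp only [Pi.mul_apply, Function.const_apply]
    rw [constC, Real.div_rpow hα.le zero_le_two,
      show δ + ((m : ℝ) * q + 1) / 2 = m * q / 2 + (δ + 1 / 2) by ring,
      Real.rpow_add hα (m * q / 2),
      show ((m : ℝ) * q - 1) / 2 = m * q / 2 - 1 / 2 by ring, Real.rpow_sub two_pos,
      Real.sqrt_eq_rpow]
    field_simp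

/-! ### Asymptotics of the Shannon integrals -/

lemma constC_two (m : ℕ) (hm : 1 ≤ m) :
    m * constC m 2 = Real.sqrt (2 * Real.pi) / ((m - 1)! : ℝ) := by
  obtain ⟨n, rfl⟩ := Nat.exists_eq_add_of_le' hm
  have h2 : (2 : ℝ) ^ ((((n + 1 : ℕ) : ℝ) * 2 - 1) / 2) = 2 ^ (n + 1) / Real.sqrt 2 := by
    rw [show (((n + 1 : ℕ) : ℝ) * 2 - 1) / 2 = ((n + 1 : ℕ) : ℝ) - 1 / 2 by ring,
      Real.rpow_sub two_pos, Real.rpow_natCast, ← Real.sqrt_eq_rpow]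
  rw [constC, normHermite_two, h2, Real.rpow_two, Real.sqrt_mul zero_le_two,
    Nat.add_sub_cancel, Nat.factorial_succ]
  push_cast
  field_simp

/-- The Shannon integrand at the scaled point splits into a leading part of order `log α` and a
bounded part. -/
lemma scaled_sq_mul_log {m : ℕ} {α : ℝ} (hα : 1 < α) (t : ℝ) :
    (2 / α) ^ m * (|laguerreL m α (α + α * Real.sqrt (2 / α) * t)| ^ 2 *
        Real.log (|laguerreL m α (α + α * Real.sqrt (2 / α) * t)| ^ 2)) / Real.log α =
      scaledLaguerre m (Real.sqrt (2 / α)) t ^ 2 *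
          Real.log (scaledLaguerre m (Real.sqrt (2 / α)) t ^ 2) / Real.log α +
        m * scaledLaguerre m (Real.sqrt (2 / α)) t ^ 2 * (1 - Real.log 2 / Real.log α) := by
  have hα0 : 0 < α := by linarith
  have hlog : Real.log α ≠ 0 := (Real.log_pos hα).ne'
  have hs2 : (Real.sqrt (2 / α) ^ m) ^ 2 = (2 / α) ^ m := by
    rw [← pow_mul, mul_comm m 2, pow_mul, Real.sq_sqrt (by positivity)]
  rw [← scaledLaguerre_sqrt_two_div m hα0, mul_pow, hs2, sq_abs]
  generalize laguerreL m α _ = L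
  rcases eq_or_ne L 0 with rfl | hL
  · simp
  · rw [Real.log_mul (by positivity) (by positivity), Real.log_pow (2 / α),
      Real.log_div two_ne_zero hα0.ne']
    field_simp
    ring

lemma tendsto_integral_scaled_sq_mul_log (m : ℕ) (δ : ℝ) :
    Tendsto (fun α => (∫ x in Set.Ioi (0 : ℝ), x ^ (α + δ) * Real.exp (-x) *
        ((2 / α) ^ m * (|laguerreL m α x| ^ 2 * Real.log (|laguerreL m α x| ^ 2)) / Real.log α)) /
      ((α / Real.exp 1) ^ α * α ^ (δ + 1 / 2))) atTop
      (𝓝 (Real.sqrt 2 * (m * (normHermite 2 m / (m ! : ℝ) ^ 2)))) := by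
  -- The integrand is bounded through `1 + Q ^ 4`, so rate `1/64` for `Q` becomes the admissible
  -- `1/16`.
  obtain ⟨C, hC, h⟩ := exists_abs_scaledLaguerre_le m (1 / 64) (by norm_num)
  have hinv : Tendsto (fun α : ℝ => (Real.log α)⁻¹) atTop (𝓝 0) :=
    Real.tendsto_log_atTop.inv_tendsto_atTop
  have key := tendsto_integral_rpow_mul_exp_neg δ ((1 + m) * (1 + C ^ 4))
    (fun α x => (2 / α) ^ m * (|laguerreL m α x| ^ 2 * Real.log (|laguerreL m α x| ^ 2))
      / Real.log α)
    (fun t => m * (hermiteH m t ^ 2 / (m ! : ℝ) ^ 2)) ?_ ?_ ?_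
  · convert key using 3
    rw [normHermite, unweightedNorm, setIntegral_univ, ← integral_div, ← integral_const_mul]
    refine integral_congr_ae (Eventually.of_forall fun t => ?_)
    simp only [hermiteWeight, Real.rpow_two, sq_abs]
    ring
  · intro α
    have hm : Measurable (laguerreL m α) := (continuous_laguerreL m α).measurable
    exact (((hm.abs.pow_const 2).mul
      (Real.measurable_log.comp (hm.abs.pow_const 2))).const_mul _).div_const _
  · intro t
    have hQ := (tendsto_scaledLaguerre m t).pow 2
    have h1 := ((Real.continuous_mul_log.tendsto _).comp hQ).mul hinv
    have h2 := (hQ.const_mul (m : ℝ)).mul ((hinv.const_mul (Real.log 2)).const_sub 1)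
    have h3 := h1.add h2
    have e : ((-1) ^ m * hermiteH m t / (m ! : ℝ)) ^ 2 = hermiteH m t ^ 2 / (m ! : ℝ) ^ 2 := by
      rw [div_pow, mul_pow, ← pow_mul, mul_comm m 2, pow_mul, neg_one_sq, one_pow, one_mul]
    rw [mul_zero, mul_zero, sub_zero, mul_one, zero_add, e] at h3
    refine h3.congr' ?_
    -- `α ≥ e` makes `log α ≥ 1`, so dividing by `log α` does not enlarge the bounds.
    filter_upwards [eventually_gt_atTop 1] with α hα
    rw [scaled_sq_mul_log hα]
    simp only [Function.comp, div_eq_mul_inv]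
  · filter_upwards [eventually_ge_atTop (Real.exp 1), eventually_sqrt_two_div_le_one]
      with α hα hs1 t
    have hα1 : 1 < α := (Real.one_lt_exp_iff.2 one_pos).trans_le hα
    have hlog : 1 ≤ Real.log α := by rwa [Real.le_log_iff_exp_le (by linarith)]
    have hQ := one_add_pow_four_le (by norm_num) (abs_nonneg t)
      (h _ t (Real.sqrt_nonneg (2 / α)) hs1)
    rw [scaled_sq_mul_log hα1]
    generalize scaledLaguerre m (Real.sqrt (2 / α)) t = Q at hQ
    have hl2 : |1 - Real.log 2 / Real.log α| ≤ 1 := by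
      have h0 : 0 ≤ Real.log 2 := Real.log_nonneg one_le_two
      have h1 : Real.log 2 / Real.log α ≤ Real.log 2 := div_le_self h0 hlog
      have h2 : 0 ≤ Real.log 2 / Real.log α := by positivity
      have h3 := Real.log_two_lt_d9
      rw [abs_le]
      constructor <;> linarith
    have hA : |Q ^ 2 * Real.log (Q ^ 2) / Real.log α| ≤ 1 + (Q ^ 2) ^ 2 := by
      rw [abs_div, abs_of_nonneg (by linarith : 0 ≤ Real.log α)]
      exact (div_le_self (abs_nonneg _) hlog).trans (abs_mul_log_le (sq_nonneg Q))
    have hB : |m * Q ^ 2 * (1 - Real.log 2 / Real.log α)| ≤ m * (1 + (Q ^ 2) ^ 2) := by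
      rw [abs_mul, abs_of_nonneg (by positivity : 0 ≤ m * Q ^ 2)]
      refine (mul_le_of_le_one_right (by positivity) hl2).trans
        (mul_le_mul_of_nonneg_left ?_ m.cast_nonneg)
      nlinarith [sq_nonneg (Q ^ 2 - 1)]
    calc _ ≤ (1 + m) * (1 + (Q ^ 2) ^ 2) := by
          refine (abs_add_le _ _).trans ?_
          linarith
      _ ≤ (1 + m) * ((1 + C ^ 4) * Real.exp (4 * (1 / 64) * |t|)) :=
          mul_le_mul_of_nonneg_left hQ (by positivity)
      _ = _ := by ring_nf

theorem isEquivalent_integral_laguerreL_sq_mul_log (m : ℕ) (hm : 1 ≤ m) (δ : ℝ) :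
    (fun α : ℝ => ∫ x in Set.Ioi (0 : ℝ),
          x ^ (α + δ) * Real.exp (-x) * |laguerreL m α x| ^ 2 *
            Real.log (|laguerreL m α x| ^ 2)) ~[atTop]
        (fun α : ℝ => Real.sqrt (2 * Real.pi) / ((m - 1)! : ℝ) * (α / Real.exp 1) ^ α *
          α ^ (δ + (m : ℝ) + 1 / 2) * Real.log α) := by
  have hN := normHermite_pos m two_pos
  have hm0 : (0 : ℝ) < m := by exact_mod_cast hm
  have hlim := (isEquivalent_const_iff_tendsto (by positivity)).2
    (tendsto_integral_scaled_sq_mul_log m δ)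
  have hmul := hlim.mul (IsEquivalent.refl (u := fun α : ℝ => (α / 2) ^ m * Real.log α *
    ((α / Real.exp 1) ^ α * α ^ (δ + 1 / 2))))
  refine (hmul.congr_left ?_).congr_right ?_
  · filter_upwards [eventually_gt_atTop 1] with α hα
    have hα0 : 0 < α := by linarith
    have hlog : 0 < Real.log α := Real.log_pos hα
    have hI : (∫ x in Set.Ioi (0 : ℝ), x ^ (α + δ) * Real.exp (-x) *
        ((2 / α) ^ m * (|laguerreL m α x| ^ 2 * Real.log (|laguerreL m α x| ^ 2)) / Real.log α))
        = (2 / α) ^ m / Real.log α * ∫ x in Set.Ioi (0 : ℝ),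
          x ^ (α + δ) * Real.exp (-x) * |laguerreL m α x| ^ 2 *
            Real.log (|laguerreL m α x| ^ 2) := by
      rw [← integral_const_mul]
      exact integral_congr_ae (Eventually.of_forall fun x => by ring)
    simp only [Pi.mul_apply]
    rw [hI]
    have : (α / Real.exp 1) ^ α ≠ 0 := by positivity
    have : α ^ (δ + 1 / 2) ≠ 0 := by positivity
    simp only [div_pow]
    field_simp
  · filter_upwards [eventually_gt_atTop 0] with α hα
    have hc : Real.sqrt 2 * (m * (normHermite 2 m / (m ! : ℝ) ^ 2)) = 2 ^ m * (m * constC m 2) := by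
      rw [constC, show ((m : ℝ) * 2 - 1) / 2 = m - 1 / 2 by ring, Real.rpow_sub two_pos,
        Real.rpow_natCast, ← Real.sqrt_eq_rpow, Real.rpow_two]
      field_simp
    simp only [Pi.mul_apply, Function.const_apply]
    rw [hc, constC_two m hm, show δ + (m : ℝ) + 1 / 2 = m + (δ + 1 / 2) by ring,
      Real.rpow_add hα m, Real.rpow_natCast, div_pow]
    field_simp

end

theorem mainTheorem5 (m : ℕ) (hm : 1 ≤ m) :
    -- power integrals
    (∀ δ q : ℝ, 0 < q →
      Integrable (fun x : ℝ => |hermiteH m x| ^ q * hermiteWeight x) ∧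
      (∀ α : ℝ, -1 < α → -1 < α + δ →
        IntegrableOn (fun x : ℝ => x ^ (α + δ) * Real.exp (-x) * |laguerreL m α x| ^ q)
          (Set.Ioi 0)) ∧
      (fun α : ℝ => ∫ x in Set.Ioi (0 : ℝ),
          x ^ (α + δ) * Real.exp (-x) * |laguerreL m α x| ^ q) ~[atTop]
        (fun α : ℝ => constC m q * (α / Real.exp 1) ^ α * α ^ (δ + ((m : ℝ) * q + 1) / 2))) ∧
    -- Shannon-type integrals
    (∀ δ : ℝ,
      (∀ α : ℝ, -1 < α → -1 < α + δ →
        IntegrableOn (fun x : ℝ => x ^ (α + δ) * Real.exp (-x) * |laguerreL m α x| ^ 2 *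
          Real.log (|laguerreL m α x| ^ 2)) (Set.Ioi 0)) ∧
      (fun α : ℝ => ∫ x in Set.Ioi (0 : ℝ),
          x ^ (α + δ) * Real.exp (-x) * |laguerreL m α x| ^ 2 *
            Real.log (|laguerreL m α x| ^ 2)) ~[atTop]
        (fun α : ℝ => Real.sqrt (2 * Real.pi) / ((m - 1)! : ℝ) * (α / Real.exp 1) ^ α *
          α ^ (δ + (m : ℝ) + 1 / 2) * Real.log α)) ∧
    -- the unweighted norms of the Laguerre polynomials
    (∀ q : ℝ, 0 < q →
      (fun α : ℝ => normLaguerre q m α) ~[atTop]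
        (fun α : ℝ => constC m q * (α / Real.exp 1) ^ α * α ^ (((m : ℝ) * q + 1) / 2))) ∧
    -- the Shannon entropy of the Laguerre polynomials
    (fun α : ℝ => entropyLaguerre m α) ~[atTop]
      (fun α : ℝ => -(Real.sqrt (2 * Real.pi) / ((m - 1)! : ℝ) * (α / Real.exp 1) ^ α *
        α ^ ((m : ℝ) + 1 / 2) * Real.log α)) := by
  refine ⟨fun δ q hq => ⟨integrable_abs_hermiteH_rpow m hq,
      fun α _ h => integrableOn_abs_laguerreL_rpow m α h hq,
      isEquivalent_integral_abs_laguerreL_rpow m δ hq⟩,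
    fun δ => ⟨fun α _ h => integrableOn_laguerreL_sq_mul_log m α h,
      isEquivalent_integral_laguerreL_sq_mul_log m hm δ⟩, fun q hq => ?_, ?_⟩
  -- The norm, and likewise the entropy up to sign, is the case `δ = 0`.
  · have h := isEquivalent_integral_abs_laguerreL_rpow m 0 hq
    simp only [add_zero, zero_add] at h
    convert h using 2 with α
    refine integral_congr_ae (Eventually.of_forall fun x => ?_)
    simp only [laguerreWeight]
    ring
  · have h := (isEquivalent_integral_laguerreL_sq_mul_log m hm 0).neg
    simp only [add_zero, zero_add] at h
    refine h.congr_left (Eventually.of_forall fun α => ?_)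
    simp only [entropyLaguerre, shannonE]
    congr 1
    refine integral_congr_ae (Eventually.of_forall fun x => ?_)
    simp only [laguerreWeight, sq_abs]
    ring
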